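/- \textbf{Theorem (Takahasi).} Let $A$ be a finite alphabet and let $F_A$ be the free group on $A$. Finitely generated subgroups of $F_A$ are represented by finite lists of words over $A\cup A^{-1}$ that generate them. There is an algorithm (a computable function on such lists) which, given a finite generating list of a finitely generated subgroup $H\le F_A$, outputs finite generating lists of finitely many finitely generated subgroups $K_1,\dots,K_m\le F_A$, each containing $H$, such that for every finitely generated subgroup $K\le F_A$ the following conditions are equivalent: (i) $H\le K$; (ii) $K_i$ is a free factor of $K$ for some $i\in\{1,\dots,m\}$, i.e. $K_i$ is generated by a subset of a basis of the free group $K$. Moreover, the Stallings automata $\mathcal S(K_1),\dots,\mathcal S(K_m)$ are, up to isomorphism, exactly the morphic images of $\mathcal S(H)$. Here, automata are over the involutive alphabet $A\cup A^{-1}$, with a basepoint that is the unique initial and the unique final state. Such an automaton is inverse if it contains with every edge $(p,x,q)$ also the edge $(q,x^{-1},p)$, is deterministic, and every vertex lies on a path from the basepoint to itself. The Stallings automaton $\mathcal S(H)$ of $H=\langle X\rangle$, $X$ finite, is the inverse automaton obtained as follows: glue to the basepoint, for every $x\in X$, a closed path (together with the inverse edges) labelled by the reduced form of $x$; then, as long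 as there are two distinct edges $(p,a,q)$ and $(p,a,r)$, identify them (folding). A morphism of automata is a map between the vertex sets that preserves the basepoint and the edges; a morphic image of $\mathcal S(H)$ is the subautomaton $\varphi(\mathcal S(H))$ of $\mathcal B$ formed by the images of the vertices and edges of $\mathcal S(H)$ under a morphism $\varphi:\mathcal S(H)\to\mathcal B$ into an inverse automaton $\mathcal B$. -/

import Mathlib

universe u

/-- Words over the involutive alphabet `A ∪ A⁻¹`: the letter `(a, true)` is `a` and `(a, false)` is
its formal inverse. -/
abbrev FWord (A : Type u) : Type u := List (A × Bool)

/-- The formal inverse of a letter. -/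
def letterInv {A : Type u} (x : A × Bool) : A × Bool := (x.1, !x.2)

/-- An automaton over `A ∪ A⁻¹` whose unique initial state is also its unique final state (the
basepoint).  `Edge p x q` says that `(p, x, q)` is an edge. -/
structure BasedAutomaton (A : Type u) where
  V : Type u
  base : V
  Edge : V → A × Bool → V → Prop

namespace BasedAutomaton

variable {A : Type u}

/-- `𝒜.Path p w q`: there is a path from `p` to `q` labelled by `w`. -/
inductive Path (𝒜 : BasedAutomaton A) : 𝒜.V → FWord A → 𝒜.V → Prop
  | nil (p : 𝒜.V) : Path 𝒜 p [] p
  | cons {p q r : 𝒜.V} {x : A × Bool} {w : FWord A} :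
      𝒜.Edge p x q → Path 𝒜 q w r → Path 𝒜 p (x :: w) r

/-- An inverse automaton with a basepoint: involutive, deterministic and trim (every vertex lies on
a successful path). -/
structure IsInverse (𝒜 : BasedAutomaton A) : Prop where
  involutive : ∀ p x q, 𝒜.Edge p x q → 𝒜.Edge q (letterInv x) p
  deterministic : ∀ p x q r, 𝒜.Edge p x q → 𝒜.Edge p x r → q = r
  trim : ∀ q, ∃ u v, 𝒜.Path 𝒜.base u q ∧ 𝒜.Path q v 𝒜.base

/-- Morphisms of automata: vertex maps preserving the initial and final vertex and the edges. -/
structure Hom (𝒜 ℬ : BasedAutomaton A) where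
  toFun : 𝒜.V → ℬ.V
  map_base : toFun 𝒜.base = ℬ.base
  map_edge : ∀ p x q, 𝒜.Edge p x q → ℬ.Edge (toFun p) x (toFun q)

/-- Isomorphisms of automata. -/
structure Iso (𝒜 ℬ : BasedAutomaton A) where
  toEquiv : 𝒜.V ≃ ℬ.V
  map_base : toEquiv 𝒜.base = ℬ.base
  map_edge : ∀ p x q, 𝒜.Edge p x q ↔ ℬ.Edge (toEquiv p) x (toEquiv q)

/-- The morphic image `φ(𝒜)`: the subautomaton of `ℬ` formed by the images of the vertices and of
the edges of `𝒜`.  (When `𝒜` is inverse, each of its vertices and edges lies on a successful path,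
so this is the subautomaton formed by the images of the successful paths.) -/
def Hom.image {𝒜 ℬ : BasedAutomaton A} (φ : Hom 𝒜 ℬ) : BasedAutomaton A where
  V := {v : ℬ.V // ∃ p, φ.toFun p = v}
  base := ⟨ℬ.base, 𝒜.base, φ.map_base⟩
  Edge v x w := ∃ p q, 𝒜.Edge p x q ∧ φ.toFun p = v.1 ∧ φ.toFun q = w.1

/-- The vertex identifications forced by Stallings foldings: whenever `p` and `p'` have been
identified (possibly `p = p'`) and `(p, x, q)`, `(p', x, r)` are edges, these edges get folded, so
that `q` and `r` are identified. -/
inductive FoldRel (𝒜 : BasedAutomaton A) : 𝒜.V → 𝒜.V → Prop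
  | refl (p : 𝒜.V) : FoldRel 𝒜 p p
  | symm {p q : 𝒜.V} : FoldRel 𝒜 p q → FoldRel 𝒜 q p
  | trans {p q r : 𝒜.V} : FoldRel 𝒜 p q → FoldRel 𝒜 q r → FoldRel 𝒜 p r
  | fold {p p' q r : 𝒜.V} {x : A × Bool} :
      FoldRel 𝒜 p p' → 𝒜.Edge p x q → 𝒜.Edge p' x r → FoldRel 𝒜 q r

def foldSetoid (𝒜 : BasedAutomaton A) : Setoid 𝒜.V where
  r := 𝒜.FoldRel
  iseqv := ⟨FoldRel.refl, FoldRel.symm, FoldRel.trans⟩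

/-- The automaton obtained from `𝒜` by folding until no folding is possible: vertices are identified
exactly as the foldings force, and parallel edges with the same label become one edge. -/
def folded (𝒜 : BasedAutomaton A) : BasedAutomaton A where
  V := Quotient 𝒜.foldSetoid
  base := Quotient.mk _ 𝒜.base
  Edge P x Q := ∃ p q, 𝒜.Edge p x q ∧ Quotient.mk _ p = P ∧ Quotient.mk _ q = Q

end BasedAutomaton

section Stallings

variable {A : Type u} [DecidableEq A]

/-- Vertices of the flower automaton of `X`: the basepoint, and, for each `g ∈ X` with reduced form
`a₁ ⋯ aₖ`, the `k - 1` intermediate vertices of its petal. -/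
inductive FlowerVertex (X : Set (FreeGroup A)) : Type u
  | base : FlowerVertex X
  | inner (g : FreeGroup A) (hg : g ∈ X) (i : ℕ) (h0 : 0 < i) (h1 : i < g.toWord.length) :
      FlowerVertex X

/-- The vertex reached after reading the first `i` letters of the petal of `g`. -/
def FlowerVertex.point {X : Set (FreeGroup A)} (g : FreeGroup A) (hg : g ∈ X) (i : ℕ) :
    FlowerVertex X :=
  if h : 0 < i ∧ i < g.toWord.length then .inner g hg i h.1 h.2 else .base

/-- Edges of the flower automaton: those of the petals and their inverse edges. -/
inductive FlowerEdge (X : Set (FreeGroup A)) : FlowerVertex X → A × Bool → FlowerVertex X → Prop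
  | forward (g : FreeGroup A) (hg : g ∈ X) (i : ℕ) (hi : i < g.toWord.length) :
      FlowerEdge X (.point g hg i) g.toWord[i] (.point g hg (i + 1))
  | backward (g : FreeGroup A) (hg : g ∈ X) (i : ℕ) (hi : i < g.toWord.length) :
      FlowerEdge X (.point g hg (i + 1)) (letterInv g.toWord[i]) (.point g hg i)

/-- The flower automaton of a set `X` of elements of the free group, given by their reduced
forms. -/
def flowerAutomaton (X : Set (FreeGroup A)) : BasedAutomaton A where
  V := FlowerVertex X
  base := .base
  Edge := FlowerEdge X

/-- The Stallings automaton of `X`, obtained by folding the flower automaton of `X`. For finite `X`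
this is the Stallings automaton of the subgroup generated by `X`. -/
def stallingsAutomaton (X : Set (FreeGroup A)) : BasedAutomaton A := (flowerAutomaton X).folded

end Stallings

/-- The finite set of elements of the free group represented by the words of a list. -/
def listElems {A : Type u} (X : List (FWord A)) : Set (FreeGroup A) :=
  {g | ∃ w ∈ X, FreeGroup.mk w = g}

/-- The finitely generated subgroup generated by the words of a list. -/
def listSubgroup {A : Type u} (X : List (FWord A)) : Subgroup (FreeGroup A) :=
  Subgroup.closure (listElems X)

/-- `L` is a free factor of the (free) group `K`: it is generated by a subset of a basis of `K`. -/
def IsFreeFactor {G : Type u} [Group G] (L K : Subgroup G) : Prop :=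
  ∃ (ι : Type u) (b : FreeGroupBasis ι K) (S : Set ι),
    L = Subgroup.closure ((fun i => ((b i : K) : G)) '' S)

/-! An inverse automaton has a group of loops, and two paths from the basepoint end at the same
vertex exactly when the quotient of their labels is a loop. `exists_stallingsHom` is the universal
property: if the loops of `ℬ` contain `X`, the Stallings automaton of `X` maps to `ℬ`. By
`image_loops_eq_closure`, the loops of the image are generated by `X` and the elements `u * v⁻¹`,
for prefixes `u`, `v` of reduced generators that end at the same vertex of `ℬ`. There are finitely
many prefixes, so `takahasiList` enumerates all sets of pairs `(u, v)` and adjoins the quotients to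
`X`; no folding is computed. Every morphic image arises in this way, and conversely every listed
group gives one, by `loops_image_of_mem_takahasiList` and `stallings_iso_image`.

If `H ≤ K`, map the Stallings automaton of `H` to the Schreier automaton of `K`. The image is a
connected subgraph; a spanning tree of it extends to a spanning tree of the whole graph. The
Schreier generators of the edges off the tree form a basis of `K`, and those of edges in the image
generate its loops, which are therefore a free factor (`image_loops_isFreeFactor`). -/

namespace BasedAutomaton

variable {A : Type u} {𝒜 ℬ 𝒞 : BasedAutomaton A}

/-! ### Paths and their labels -/

theorem Path.single {p q : 𝒜.V} {x : A × Bool} (h : 𝒜.Edge p x q) : 𝒜.Path p [x] q :=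
  .cons h (.nil q)

theorem path_nil {p q : 𝒜.V} : 𝒜.Path p [] q ↔ p = q := by
  constructor
  · rintro ⟨⟩; rfl
  · rintro rfl; exact .nil p

theorem path_cons {p q : 𝒜.V} {x : A × Bool} {w : FWord A} :
    𝒜.Path p (x :: w) q ↔ ∃ r, 𝒜.Edge p x r ∧ 𝒜.Path r w q := by
  constructor
  · rintro (_ | ⟨h, h'⟩); exact ⟨_, h, h'⟩
  · rintro ⟨r, h, h'⟩; exact .cons h h'

theorem path_append {p q : 𝒜.V} {u v : FWord A} :
    𝒜.Path p (u ++ v) q ↔ ∃ r, 𝒜.Path p u r ∧ 𝒜.Path r v q := by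
  induction u generalizing p with
  | nil => simp [path_nil]
  | cons x u ih =>
    simp only [List.cons_append, path_cons, ih]
    constructor
    · rintro ⟨r, h, s, h1, h2⟩; exact ⟨s, ⟨r, h, h1⟩, h2⟩
    · rintro ⟨s, ⟨r, h, h1⟩, h2⟩; exact ⟨r, h, s, h1, h2⟩

theorem Path.append {p q r : 𝒜.V} {u v : FWord A} (h : 𝒜.Path p u q) (h' : 𝒜.Path q v r) :
    𝒜.Path p (u ++ v) r :=
  path_append.2 ⟨q, h, h'⟩

theorem Path.map (φ : Hom 𝒜 ℬ) {p q : 𝒜.V} {w : FWord A} (h : 𝒜.Path p w q) :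
    ℬ.Path (φ.toFun p) w (φ.toFun q) := by
  induction h with
  | nil p => exact .nil _
  | cons h _ ih => exact .cons (φ.map_edge _ _ _ h) ih

theorem Path.map_base (φ : Hom 𝒜 ℬ) {q : 𝒜.V} {w : FWord A} (h : 𝒜.Path 𝒜.base w q) :
    ℬ.Path ℬ.base w (φ.toFun q) :=
  φ.map_base ▸ h.map φ

theorem letterInv_letterInv (x : A × Bool) : letterInv (letterInv x) = x := by
  simp [letterInv]

theorem mk_letterInv (x : A × Bool) :
    FreeGroup.mk [letterInv x] = (FreeGroup.mk [x])⁻¹ := rfl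

theorem mk_cons (x : A × Bool) (w : FWord A) :
    FreeGroup.mk (x :: w) = FreeGroup.mk [x] * FreeGroup.mk w := rfl

/-- Every edge has an inverse edge. -/
def Involutive (𝒜 : BasedAutomaton A) : Prop :=
  ∀ p x q, 𝒜.Edge p x q → 𝒜.Edge q (letterInv x) p

theorem Path.invRev (h𝒜 : 𝒜.Involutive) {p q : 𝒜.V} {w : FWord A} (h : 𝒜.Path p w q) :
    𝒜.Path q (FreeGroup.invRev w) p := by
  induction h with
  | nil p => exact .nil _
  | cons h _ ih =>
    rw [FreeGroup.invRev_cons]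
    exact ih.append (.single (h𝒜 _ _ _ h))

theorem trim_of_path (h𝒜 : 𝒜.Involutive) (h : ∀ q, ∃ u, 𝒜.Path 𝒜.base u q) (q : 𝒜.V) :
    ∃ u v, 𝒜.Path 𝒜.base u q ∧ 𝒜.Path q v 𝒜.base :=
  let ⟨u, hu⟩ := h q
  ⟨u, _, hu, hu.invRev h𝒜⟩

/-! ### Inverse automata and their groups of loops -/

namespace IsInverse

theorem exists_path (h𝒜 : 𝒜.IsInverse) (q : 𝒜.V) : ∃ u, 𝒜.Path 𝒜.base u q :=
  let ⟨u, _, hu, _⟩ := h𝒜.trim q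
  ⟨u, hu⟩

theorem path_unique (h𝒜 : 𝒜.IsInverse) {p q r : 𝒜.V} {w : FWord A} (h : 𝒜.Path p w q)
    (h' : 𝒜.Path p w r) : q = r := by
  induction h with
  | nil p => exact path_nil.1 h'
  | cons h _ ih =>
    obtain ⟨s, hs, hs'⟩ := path_cons.1 h'
    obtain rfl := h𝒜.deterministic _ _ _ _ h hs
    exact ih hs'

/-- Reading a letter and then its inverse leads back to the same vertex, by involutivity and
determinism, so the cancelled pair can be cut out of the path. -/
theorem path_of_step (h𝒜 : 𝒜.IsInverse) {p q : 𝒜.V} {w w' : FWord A}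
    (hw : FreeGroup.Red.Step w w') (h : 𝒜.Path p w q) : 𝒜.Path p w' q := by
  obtain ⟨L, L', x, b⟩ := hw
  obtain ⟨r, h1, h2⟩ := path_append.1 h
  obtain ⟨s, h3, h4⟩ := path_cons.1 h2
  obtain ⟨t, h5, h6⟩ := path_cons.1 h4
  obtain rfl := h𝒜.deterministic _ _ _ _ (h𝒜.involutive _ _ _ h3) h5
  exact h1.append h6

theorem path_of_red (h𝒜 : 𝒜.IsInverse) {p q : 𝒜.V} {w w' : FWord A}
    (hw : FreeGroup.Red w w') (h : 𝒜.Path p w q) : 𝒜.Path p w' q := by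
  induction hw with
  | refl => exact h
  | tail _ hs ih => exact h𝒜.path_of_step hs ih

theorem path_toWord [DecidableEq A] (h𝒜 : 𝒜.IsInverse) {p q : 𝒜.V} {w : FWord A}
    (h : 𝒜.Path p w q) : 𝒜.Path p (FreeGroup.mk w).toWord q :=
  h𝒜.path_of_red FreeGroup.reduce.red h

theorem eq_of_mk_eq (h𝒜 : 𝒜.IsInverse) {p q q' : 𝒜.V} {w w' : FWord A}
    (h : 𝒜.Path p w q) (h' : 𝒜.Path p w' q') (hw : FreeGroup.mk w = FreeGroup.mk w') :
    q = q' := by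
  classical
  exact h𝒜.path_unique (h𝒜.path_toWord h) (hw ▸ h𝒜.path_toWord h')

/-- The subgroup of the elements represented by labels of closed paths at the basepoint. -/
def loops (h𝒜 : 𝒜.IsInverse) : Subgroup (FreeGroup A) where
  carrier := {g | ∃ w, 𝒜.Path 𝒜.base w 𝒜.base ∧ FreeGroup.mk w = g}
  one_mem' := ⟨[], .nil _, rfl⟩
  mul_mem' := by
    rintro _ _ ⟨u, hu, rfl⟩ ⟨v, hv, rfl⟩
    exact ⟨u ++ v, hu.append hv, rfl⟩
  inv_mem' := by
    rintro _ ⟨u, hu, rfl⟩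
    exact ⟨_, hu.invRev h𝒜.involutive, rfl⟩

theorem path_toWord_of_mem_loops [DecidableEq A] (h𝒜 : 𝒜.IsInverse) {g : FreeGroup A}
    (hg : g ∈ h𝒜.loops) : 𝒜.Path 𝒜.base g.toWord 𝒜.base := by
  obtain ⟨w, hw, rfl⟩ := hg
  exact h𝒜.path_toWord hw

theorem mul_inv_mem_loops (h𝒜 : 𝒜.IsInverse) {q : 𝒜.V} {u v : FWord A}
    (hu : 𝒜.Path 𝒜.base u q) (hv : 𝒜.Path 𝒜.base v q) :
    FreeGroup.mk u * (FreeGroup.mk v)⁻¹ ∈ h𝒜.loops :=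
  ⟨_, hu.append (hv.invRev h𝒜.involutive), rfl⟩

/-- With `mul_inv_mem_loops`, this identifies vertices with cosets of the group of loops;
injectivity of morphisms is checked through it. -/
theorem eq_of_mul_inv_mem_loops (h𝒜 : 𝒜.IsInverse) {q r : 𝒜.V} {u v : FWord A}
    (hu : 𝒜.Path 𝒜.base u q) (hv : 𝒜.Path 𝒜.base v r)
    (h : FreeGroup.mk u * (FreeGroup.mk v)⁻¹ ∈ h𝒜.loops) : q = r := by
  obtain ⟨w, hw, hwg⟩ := h
  refine h𝒜.eq_of_mk_eq hu (hw.append hv) ?_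
  rw [← FreeGroup.mul_mk, hwg, inv_mul_cancel_right]

theorem loops_mono (h𝒜 : 𝒜.IsInverse) (hℬ : ℬ.IsInverse) (φ : Hom 𝒜 ℬ) :
    h𝒜.loops ≤ hℬ.loops := by
  rintro _ ⟨w, hw, rfl⟩
  exact ⟨w, φ.map_base ▸ hw.map_base φ, rfl⟩

theorem hom_unique (h𝒜 : 𝒜.IsInverse) (hℬ : ℬ.IsInverse) (φ ψ : Hom 𝒜 ℬ) (p : 𝒜.V) :
    φ.toFun p = ψ.toFun p := by
  obtain ⟨u, hu⟩ := h𝒜.exists_path p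
  exact hℬ.path_unique (hu.map_base φ) (hu.map_base ψ)

end IsInverse

/-! ### Morphic images and folding -/

/-- Composition of morphisms. -/
def Hom.comp (ψ : Hom ℬ 𝒞) (φ : Hom 𝒜 ℬ) : Hom 𝒜 𝒞 where
  toFun p := ψ.toFun (φ.toFun p)
  map_base := by rw [φ.map_base, ψ.map_base]
  map_edge p x q h := ψ.map_edge _ _ _ (φ.map_edge _ _ _ h)

/-- The corestriction of a morphism to its image. -/
def Hom.toImage (φ : Hom 𝒜 ℬ) : Hom 𝒜 φ.image where
  toFun p := ⟨φ.toFun p, p, rfl⟩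
  map_base := Subtype.ext φ.map_base
  map_edge p _ q h := ⟨p, q, h, rfl, rfl⟩

/-- The inclusion of the image of a morphism. -/
def Hom.ofImage (φ : Hom 𝒜 ℬ) : Hom φ.image ℬ where
  toFun v := v.1
  map_base := rfl
  map_edge := by
    rintro v x w ⟨p, q, h, hp, hq⟩
    rw [← hp, ← hq]
    exact φ.map_edge _ _ _ h

theorem Hom.toImage_surjective (φ : Hom 𝒜 ℬ) (v : φ.image.V) : ∃ p, φ.toImage.toFun p = v :=
  let ⟨p, hp⟩ := v.2
  ⟨p, Subtype.ext hp⟩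

theorem Hom.image_isInverse (φ : Hom 𝒜 ℬ) (h𝒜 : 𝒜.IsInverse) (hℬ : ℬ.IsInverse) :
    φ.image.IsInverse where
  involutive := by
    rintro v x w ⟨p, q, h, hp, hq⟩
    exact ⟨q, p, h𝒜.involutive _ _ _ h, hq, hp⟩
  deterministic v x w w' h h' :=
    Subtype.ext (hℬ.deterministic _ _ _ _ (φ.ofImage.map_edge _ _ _ h)
      (φ.ofImage.map_edge _ _ _ h'))
  trim v := by
    obtain ⟨p, rfl⟩ := φ.toImage_surjective v
    obtain ⟨u, w, hu, hw⟩ := h𝒜.trim p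
    exact ⟨u, w, hu.map_base _, φ.toImage.map_base ▸ hw.map φ.toImage⟩

/-- The projection onto the folded automaton. -/
def toFolded (𝒜 : BasedAutomaton A) : Hom 𝒜 𝒜.folded where
  toFun p := Quotient.mk 𝒜.foldSetoid p
  map_base := rfl
  map_edge p _ q h := ⟨p, q, h, rfl, rfl⟩

theorem toFolded_surjective (P : 𝒜.folded.V) : ∃ p, 𝒜.toFolded.toFun p = P :=
  Quotient.exists_rep P

theorem folded_isInverse (h𝒜 : 𝒜.Involutive) (h : ∀ q, ∃ u, 𝒜.Path 𝒜.base u q) :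
    𝒜.folded.IsInverse where
  involutive := by
    rintro _ x _ ⟨p, q, h, rfl, rfl⟩
    exact ⟨q, p, h𝒜 _ _ _ h, rfl, rfl⟩
  deterministic := by
    rintro P x _ _ ⟨p, q, h, hp, rfl⟩ ⟨p', q', h', hp', rfl⟩
    exact Quotient.sound (FoldRel.fold (Quotient.exact (hp.trans hp'.symm)) h h')
  trim P := by
    obtain ⟨p, rfl⟩ := toFolded_surjective P
    obtain ⟨u, v, hu, hv⟩ := trim_of_path h𝒜 h p
    exact ⟨u, v, hu.map 𝒜.toFolded, hv.map 𝒜.toFolded⟩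

/-- A deterministic target has already made every identification that folding forces. -/
theorem Hom.eq_of_foldRel (φ : Hom 𝒜 ℬ) (hℬ : ℬ.IsInverse) {p q : 𝒜.V}
    (h : 𝒜.FoldRel p q) : φ.toFun p = φ.toFun q := by
  induction h with
  | refl p => rfl
  | symm _ ih => exact ih.symm
  | trans _ _ ih ih' => exact ih.trans ih'
  | fold _ h1 h2 ih =>
    exact hℬ.deterministic _ _ _ _ (φ.map_edge _ _ _ h1) (ih ▸ φ.map_edge _ _ _ h2)

/-- A morphism into an inverse automaton factors through the folded automaton. -/
def Hom.foldLift (φ : Hom 𝒜 ℬ) (hℬ : ℬ.IsInverse) : Hom 𝒜.folded ℬ where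
  toFun := Quotient.lift φ.toFun fun _ _ h => φ.eq_of_foldRel hℬ h
  map_base := φ.map_base
  map_edge := by
    rintro _ x _ ⟨p, q, h, rfl, rfl⟩
    exact φ.map_edge _ _ _ h

end BasedAutomaton

open BasedAutomaton

/-! ### Flower, Stallings and Schreier automata -/

section Flower

variable {A : Type u} [DecidableEq A] {X Y : Set (FreeGroup A)}

@[simp] theorem FlowerVertex.point_zero (g : FreeGroup A) (hg : g ∈ X) :
    FlowerVertex.point g hg 0 = .base := by
  simp [FlowerVertex.point]

@[simp] theorem FlowerVertex.point_length (g : FreeGroup A) (hg : g ∈ X) :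
    FlowerVertex.point g hg g.toWord.length = .base := by
  simp [FlowerVertex.point]

theorem flower_involutive (X : Set (FreeGroup A)) : (flowerAutomaton X).Involutive := by
  rintro _ _ _ (⟨g, hg, i, hi⟩ | ⟨g, hg, i, hi⟩)
  · exact .backward g hg i hi
  · rw [letterInv_letterInv]; exact .forward g hg i hi

theorem flower_path_take (g : FreeGroup A) (hg : g ∈ X) (i : ℕ) (hi : i ≤ g.toWord.length) :
    (flowerAutomaton X).Path (flowerAutomaton X).base (g.toWord.take i) (.point g hg i) := by
  induction i with
  | zero => rw [FlowerVertex.point_zero]; exact .nil _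
  | succ i ih =>
    rw [List.take_succ_eq_append_getElem (by omega)]
    exact (ih (by omega)).append (.single (.forward g hg i (by omega)))

theorem flower_reachable (q : (flowerAutomaton X).V) :
    ∃ u, (flowerAutomaton X).Path (flowerAutomaton X).base u q := by
  rcases q with _ | ⟨g, hg, i, h0, h1⟩
  · exact ⟨[], .nil _⟩
  · have := flower_path_take g hg i h1.le
    rw [FlowerVertex.point, dif_pos ⟨h0, h1⟩] at this
    exact ⟨_, this⟩

theorem stallings_isInverse (X : Set (FreeGroup A)) : (stallingsAutomaton X).IsInverse :=
  folded_isInverse (flower_involutive X) flower_reachable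

/-- The morphism from the flower automaton of `X` to an inverse automaton in which the reduced forms
of the elements of `X` label closed paths. -/
theorem exists_flowerHom {ℬ : BasedAutomaton A} (hℬ : ℬ.IsInverse) (h : ∀ g ∈ X, g ∈ hℬ.loops) :
    Nonempty (Hom (flowerAutomaton X) ℬ) := by
  -- The `i`-th vertex of the petal of `g` must go to the vertex reached by the first `i` letters of
  -- the loop `g`.
  have key : ∀ g ∈ X, ∀ i, ∃ v, ℬ.Path ℬ.base (g.toWord.take i) v := by
    intro g hg i
    have := hℬ.path_toWord_of_mem_loops (h g hg)
    rw [← List.take_append_drop i g.toWord] at this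
    obtain ⟨v, hv, -⟩ := path_append.1 this
    exact ⟨v, hv⟩
  choose f hf using key
  let F : FlowerVertex X → ℬ.V
    | .base => ℬ.base
    | .inner g hg i _ _ => f g hg i
  have hF : ∀ g (hg : g ∈ X) i, i ≤ g.toWord.length →
      ℬ.Path ℬ.base (g.toWord.take i) (F (.point g hg i)) := by
    intro g hg i hi
    rcases Nat.eq_zero_or_pos i with rfl | h0
    · rw [FlowerVertex.point_zero]; exact .nil _
    rcases hi.eq_or_lt with rfl | h1
    · rw [FlowerVertex.point_length, List.take_length]
      exact hℬ.path_toWord_of_mem_loops (h g hg)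
    · rw [FlowerVertex.point, dif_pos ⟨h0, h1⟩]; exact hf g hg i
  have hE : ∀ g (hg : g ∈ X) i (hi : i < g.toWord.length),
      ℬ.Edge (F (.point g hg i)) g.toWord[i] (F (.point g hg (i + 1))) := by
    intro g hg i hi
    have h1 := hF g hg (i + 1) hi
    rw [List.take_succ_eq_append_getElem hi] at h1
    obtain ⟨r, hr, hr'⟩ := path_append.1 h1
    obtain rfl := hℬ.path_unique (hF g hg i hi.le) hr
    obtain ⟨s, hs, hs'⟩ := path_cons.1 hr'
    rwa [← path_nil.1 hs']
  refine ⟨⟨F, rfl, ?_⟩⟩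
  rintro _ _ _ (⟨g, hg, i, hi⟩ | ⟨g, hg, i, hi⟩)
  · exact hE g hg i hi
  · exact hℬ.involutive _ _ _ (hE g hg i hi)

theorem exists_stallingsHom {ℬ : BasedAutomaton A} (hℬ : ℬ.IsInverse)
    (h : ∀ g ∈ X, g ∈ hℬ.loops) : Nonempty (Hom (stallingsAutomaton X) ℬ) :=
  (exists_flowerHom hℬ h).map fun φ => φ.foldLift hℬ

/-- The Schreier automaton of a subgroup `K`, the coset `K * g` being represented by the left coset
of `g⁻¹`. -/
def schreierAutomaton (K : Subgroup (FreeGroup A)) : BasedAutomaton A where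
  V := FreeGroup A ⧸ K
  base := (1 : FreeGroup A)
  Edge (p : FreeGroup A ⧸ K) x (q : FreeGroup A ⧸ K) := p = FreeGroup.mk [x] • q

omit [DecidableEq A] in
theorem schreier_path {K : Subgroup (FreeGroup A)} {p q : FreeGroup A ⧸ K} {w : FWord A} :
    (schreierAutomaton K).Path p w q ↔ p = FreeGroup.mk w • q := by
  induction w generalizing p with
  | nil =>
    refine path_nil.trans ?_
    rw [← FreeGroup.one_eq_mk, one_smul]
    exact Iff.rfl
  | cons x w ih =>
    refine path_cons.trans ?_
    rw [mk_cons, mul_smul]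
    constructor
    · rintro ⟨r, hr, h⟩
      exact hr.trans (congrArg _ (ih.1 h))
    · intro h
      exact ⟨_, h, ih.2 rfl⟩

theorem schreier_isInverse (K : Subgroup (FreeGroup A)) : (schreierAutomaton K).IsInverse := by
  have hinv : (schreierAutomaton K).Involutive := by
    intro (p : FreeGroup A ⧸ K) x (q : FreeGroup A ⧸ K) h
    change q = FreeGroup.mk [letterInv x] • p
    rw [mk_letterInv]
    exact eq_inv_smul_iff.2 (Eq.symm h)
  refine ⟨hinv, ?_, trim_of_path hinv ?_⟩
  · intro p x q r h h'
    exact MulAction.injective (β := FreeGroup A ⧸ K) (FreeGroup.mk [x]) (Eq.trans (Eq.symm h) h')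
  · intro (q : FreeGroup A ⧸ K)
    induction q using QuotientGroup.induction_on with
    | H g =>
      refine ⟨g⁻¹.toWord, schreier_path.2 ?_⟩
      rw [FreeGroup.mk_toWord]
      change _ = ((g⁻¹ * g : FreeGroup A) : FreeGroup A ⧸ K)
      rw [inv_mul_cancel]; rfl

theorem schreier_loops (K : Subgroup (FreeGroup A)) : (schreier_isInverse K).loops = K := by
  have key (w : FWord A) : (schreierAutomaton K).Path (schreierAutomaton K).base w
      (schreierAutomaton K).base ↔ FreeGroup.mk w ∈ K := by
    refine schreier_path.trans ?_
    change ((1 : FreeGroup A) : FreeGroup A ⧸ K) = ((FreeGroup.mk w * 1 : FreeGroup A) : _) ↔ _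
    rw [QuotientGroup.eq, inv_one, one_mul, mul_one]
  ext g
  constructor
  · rintro ⟨w, hw, rfl⟩
    exact (key w).1 hw
  · intro hg
    exact ⟨g.toWord, (key _).2 (by rwa [FreeGroup.mk_toWord]), FreeGroup.mk_toWord⟩

theorem stallings_path_toWord {g : FreeGroup A} (hg : g ∈ X) :
    (stallingsAutomaton X).Path (stallingsAutomaton X).base g.toWord
      (stallingsAutomaton X).base := by
  have := (flower_path_take g hg _ le_rfl).map_base (flowerAutomaton X).toFolded
  rwa [List.take_length, FlowerVertex.point_length] at this

/-- Folding creates no new loops: a morphism to the Schreier automaton of the closure, whose loops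
are exactly the closure, bounds them from above. -/
theorem stallings_loops (X : Set (FreeGroup A)) :
    (stallings_isInverse X).loops = Subgroup.closure X := by
  apply le_antisymm
  · obtain ⟨φ⟩ := exists_stallingsHom (X := X) (schreier_isInverse (Subgroup.closure X))
      fun g hg => by rw [schreier_loops]; exact Subgroup.subset_closure hg
    exact ((stallings_isInverse X).loops_mono (schreier_isInverse _) φ).trans_eq (schreier_loops _)
  · rw [Subgroup.closure_le]
    intro g hg
    exact ⟨_, stallings_path_toWord hg, FreeGroup.mk_toWord⟩

/-- The image of a Stallings automaton in an inverse automaton is the Stallings automaton of any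
generating set of its subgroup of loops. -/
theorem stallings_iso_image {ℬ : BasedAutomaton A} (hℬ : ℬ.IsInverse)
    (φ : Hom (stallingsAutomaton X) ℬ) (hXY : X ⊆ Subgroup.closure Y)
    (h : (φ.image_isInverse (stallings_isInverse X) hℬ).loops = Subgroup.closure Y) :
    Nonempty ((stallingsAutomaton Y).Iso φ.image) := by
  have hX := stallings_isInverse X
  have hY := stallings_isInverse Y
  have hI := φ.image_isInverse hX hℬ
  obtain ⟨ψ⟩ := exists_stallingsHom (X := Y) hI fun g hg => by
    rw [h]; exact Subgroup.subset_closure hg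
  obtain ⟨θ⟩ := exists_stallingsHom (X := X) hY fun g hg => by
    rw [stallings_loops]; exact hXY hg
  have hψθ (p) : ψ.toFun (θ.toFun p) = φ.toImage.toFun p :=
    hX.hom_unique hI (ψ.comp θ) φ.toImage p
  -- Both automata have the same group of loops, so paths that meet in the image already meet in the
  -- Stallings automaton of `Y`.
  have hinj : Function.Injective ψ.toFun := by
    intro a b hab
    obtain ⟨u, hu⟩ := hY.exists_path a
    obtain ⟨v, hv⟩ := hY.exists_path b
    refine hY.eq_of_mul_inv_mem_loops hu hv ?_
    rw [stallings_loops, ← h]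
    exact hI.mul_inv_mem_loops (hu.map_base ψ) (hab ▸ hv.map_base ψ)
  have hsurj : Function.Surjective ψ.toFun := by
    intro v
    obtain ⟨p, rfl⟩ := φ.toImage_surjective v
    exact ⟨θ.toFun p, hψθ p⟩
  refine ⟨⟨Equiv.ofBijective _ ⟨hinj, hsurj⟩, ψ.map_base, fun a x b => ⟨ψ.map_edge a x b, ?_⟩⟩⟩
  rintro ⟨p, q, hpq, hp, hq⟩
  have hp' : θ.toFun p = a := hinj ((hψθ p).trans (Subtype.ext hp))
  have hq' : θ.toFun q = b := hinj ((hψθ q).trans (Subtype.ext hq))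
  rw [← hp', ← hq']
  exact θ.map_edge _ _ _ hpq

/-- The prefixes of the reduced forms of elements of `X`. -/
def petalPrefixes (X : Set (FreeGroup A)) : Set (FWord A) :=
  {u | u = [] ∨ ∃ g ∈ X, u <+: g.toWord}

theorem stallings_exists_path_prefix {u : FWord A} (hu : u ∈ petalPrefixes X) :
    ∃ p, (stallingsAutomaton X).Path (stallingsAutomaton X).base u p := by
  obtain rfl | ⟨g, hg, v, hv⟩ := hu
  · exact ⟨_, .nil _⟩
  · have := stallings_path_toWord hg
    rw [← hv] at this
    obtain ⟨p, hp, -⟩ := path_append.1 this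
    exact ⟨p, hp⟩

/-- An edge comes from a petal, where its two ends are reached by consecutive prefixes of a
generator; such an edge contributes nothing new to the group of loops. -/
theorem stallings_exists_prefix_of_edge {p q : (stallingsAutomaton X).V} {x : A × Bool}
    (h : (stallingsAutomaton X).Edge p x q) :
    ∃ u ∈ petalPrefixes X, ∃ v ∈ petalPrefixes X,
      (stallingsAutomaton X).Path (stallingsAutomaton X).base u p ∧
      (stallingsAutomaton X).Path (stallingsAutomaton X).base v q ∧
      FreeGroup.mk u * FreeGroup.mk [x] = FreeGroup.mk v := by
  obtain ⟨_, _, ⟨g, hg, i, hi⟩ | ⟨g, hg, i, hi⟩, rfl, rfl⟩ := h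
  · refine ⟨_, .inr ⟨g, hg, List.take_prefix _ _⟩, _, .inr ⟨g, hg, List.take_prefix _ _⟩,
      (flower_path_take g hg i hi.le).map_base (toFolded _),
      (flower_path_take g hg (i + 1) hi).map_base (toFolded _), ?_⟩
    rw [List.take_succ_eq_append_getElem hi, FreeGroup.mul_mk]
  · refine ⟨_, .inr ⟨g, hg, List.take_prefix _ _⟩, _, .inr ⟨g, hg, List.take_prefix _ _⟩,
      (flower_path_take g hg (i + 1) hi).map_base (toFolded _),
      (flower_path_take g hg i hi.le).map_base (toFolded _), ?_⟩
    rw [List.take_succ_eq_append_getElem hi, mk_letterInv, ← FreeGroup.mul_mk,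
      mul_inv_cancel_right]

/-- The loops of an image of the Stallings automaton of `X` are generated by `X` together with the
elements `u * v⁻¹` where `u` and `v` are prefixes with the same end vertex. -/
theorem image_loops_eq_closure {ℬ : BasedAutomaton A} (hℬ : ℬ.IsInverse)
    (φ : Hom (stallingsAutomaton X) ℬ) :
    (φ.image_isInverse (stallings_isInverse X) hℬ).loops =
      Subgroup.closure (X ∪ {g | ∃ u ∈ petalPrefixes X, ∃ v ∈ petalPrefixes X,
        (∃ p, ℬ.Path ℬ.base u p ∧ ℬ.Path ℬ.base v p) ∧
          FreeGroup.mk u * (FreeGroup.mk v)⁻¹ = g}) := by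
  have hX := stallings_isInverse X
  have hI := φ.image_isInverse hX hℬ
  set M := Subgroup.closure (X ∪ _) with hM
  apply le_antisymm
  · have key : ∀ p w q, φ.image.Path p w q → ∀ u ∈ petalPrefixes X, ∀ v ∈ petalPrefixes X,
        φ.image.Path φ.image.base u p → φ.image.Path φ.image.base v q →
        FreeGroup.mk u * FreeGroup.mk w * (FreeGroup.mk v)⁻¹ ∈ M := by
      intro p w q h
      induction h with
      | nil p =>
        intro u hu v hv hup hvp
        rw [← FreeGroup.one_eq_mk, mul_one]
        exact Subgroup.subset_closure (.inr ⟨u, hu, v, hv,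
          ⟨_, hup.map φ.ofImage, hvp.map φ.ofImage⟩, rfl⟩)
      | @cons p r q x w hpr _ ih =>
        intro u hu v hv hup hvq
        obtain ⟨p', r', hpr', hp', hr'⟩ := hpr
        obtain rfl : φ.toImage.toFun p' = p := Subtype.ext hp'
        obtain rfl : φ.toImage.toFun r' = r := Subtype.ext hr'
        obtain ⟨u₁, hu₁, u₂, hu₂, h₁, h₂, h₁₂⟩ := stallings_exists_prefix_of_edge hpr'
        have h3 : FreeGroup.mk u * (FreeGroup.mk u₁)⁻¹ ∈ M :=
          Subgroup.subset_closure (.inr ⟨u, hu, u₁, hu₁,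
            ⟨_, hup.map φ.ofImage, (h₁.map_base φ.toImage).map φ.ofImage⟩, rfl⟩)
        -- With `u₂ = u₁ * x` in the free group, `u * x * w * v⁻¹` splits as `(u * u₁⁻¹) * (u₂ * w *
        -- v⁻¹)`.
        have := mul_mem h3 (ih u₂ hu₂ v hv (h₂.map_base _) hvq)
        rw [← h₁₂] at this
        rw [mk_cons]
        convert this using 1
        group
    rintro _ ⟨w, hw, rfl⟩
    have := key _ w _ hw [] (.inl rfl) [] (.inl rfl) (.nil _) (.nil _)
    rwa [← FreeGroup.one_eq_mk, one_mul, inv_one, mul_one] at this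
  · rw [hM, Subgroup.closure_le]
    rintro g (hg | ⟨u, hu, v, hv, ⟨p, hup, hvp⟩, rfl⟩)
    · exact hX.loops_mono hI φ.toImage ⟨_, stallings_path_toWord hg, FreeGroup.mk_toWord⟩
    · obtain ⟨a, ha⟩ := stallings_exists_path_prefix hu
      obtain ⟨b, hb⟩ := stallings_exists_path_prefix hv
      refine hI.mul_inv_mem_loops (ha.map_base φ.toImage) ?_
      have : φ.toImage.toFun a = φ.toImage.toFun b := Subtype.ext
        ((hℬ.path_unique (ha.map_base φ) hup).trans (hℬ.path_unique (hb.map_base φ) hvp).symm)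
      rw [this]
      exact hb.map_base φ.toImage

end Flower

open BasedAutomaton

/-! ### Schreier bases of subgroups of free groups -/

section Basis

variable {A : Type u} {K : Subgroup (FreeGroup A)} (s : FreeGroup A ⧸ K → FreeGroup A)

/-- The pairs `(v, a)` of a coset and a letter whose Schreier generator is not excluded by the
transversal `s`. -/
abbrev SchreierIndex : Type u :=
  {i : (FreeGroup A ⧸ K) × A // s (FreeGroup.of i.2 • i.1) ≠ FreeGroup.of i.2 * s i.1}

/-- The contribution of the edge `(v, a)` to the rewriting of an element in Schreier generators. -/
noncomputable def schreierLabel (v : FreeGroup A ⧸ K) (a : A) : FreeGroup (SchreierIndex s) :=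
  open Classical in
  if h : s (FreeGroup.of a • v) ≠ FreeGroup.of a * s v then .of ⟨(v, a), h⟩ else 1

/-- The action of the free group on pairs of a coset and a word in Schreier generators. -/
noncomputable def schreierPerm :
    FreeGroup A →* Equiv.Perm ((FreeGroup A ⧸ K) × FreeGroup (SchreierIndex s)) :=
  FreeGroup.lift fun a =>
    { toFun := fun z => (FreeGroup.of a • z.1, schreierLabel s z.1 a * z.2)
      invFun := fun z => ((FreeGroup.of a)⁻¹ • z.1,
        (schreierLabel s ((FreeGroup.of a)⁻¹ • z.1) a)⁻¹ * z.2)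
      left_inv := fun z => by simp
      right_inv := fun z => by simp }

theorem schreierPerm_of (a : A) (v : FreeGroup A ⧸ K) (g : FreeGroup (SchreierIndex s)) :
    schreierPerm s (.of a) (v, g) = (FreeGroup.of a • v, schreierLabel s v a * g) := by
  simp [schreierPerm]

/-- Labels are multiplied on the left, so the action commutes with right multiplication on the
second coordinate. This makes the rewriting map on `K` a homomorphism. -/
theorem schreierPerm_apply (w : FreeGroup A) (v : FreeGroup A ⧸ K)
    (g : FreeGroup (SchreierIndex s)) :
    schreierPerm s w (v, g) = (w • v, (schreierPerm s w (v, 1)).2 * g) := by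
  induction w using FreeGroup.induction_on generalizing v g with
  | C1 => simp
  | of a => simp [schreierPerm_of]
  | inv_of a _ =>
    have h : ∀ g, schreierPerm s (FreeGroup.of a)⁻¹ (v, g) =
        ((FreeGroup.of a)⁻¹ • v, (schreierLabel s ((FreeGroup.of a)⁻¹ • v) a)⁻¹ * g) := by
      intro g
      rw [map_inv, Equiv.Perm.inv_eq_iff_eq, schreierPerm_of]
      simp
    rw [h g, h 1, mul_one]
  | mul x y hx hy =>
    have h (g) : schreierPerm s (x * y) (v, g) = ((x * y) • v,
        (schreierPerm s x (y • v, 1)).2 * ((schreierPerm s y (v, 1)).2 * g)) := by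
      rw [map_mul, Equiv.Perm.mul_apply, hy, hx, mul_smul]
    rw [h g, h 1]
    simp [mul_assoc]

/-- The Schreier generator of `(v, a)`. -/
def schreierGen (v : FreeGroup A ⧸ K) (a : A) : FreeGroup A :=
  (s (FreeGroup.of a • v))⁻¹ * FreeGroup.of a * s v

variable {s}

theorem smul_one_coset (g : FreeGroup A) :
    g • ((1 : FreeGroup A) : FreeGroup A ⧸ K) = (g : FreeGroup A ⧸ K) := by
  rw [MulAction.Quotient.smul_mk, smul_eq_mul, mul_one]

theorem schreierGen_mem (hs : ∀ v, (s v : FreeGroup A ⧸ K) = v) (v : FreeGroup A ⧸ K) (a : A) :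
    schreierGen s v a ∈ K := by
  rw [schreierGen, mul_assoc, ← QuotientGroup.eq, hs]
  conv_lhs => rw [← hs v]
  rfl

/-- The Schreier generators of a Schreier transversal are a basis.  The hypothesis `ind` says that
any two cosets are connected by tree edges. -/
theorem exists_schreierBasis (hs : ∀ v, (s v : FreeGroup A ⧸ K) = v)
    (h1 : s (1 : FreeGroup A) = 1)
    (ind : ∀ P : FreeGroup A ⧸ K → Prop, P (1 : FreeGroup A) →
      (∀ v a, s (FreeGroup.of a • v) = FreeGroup.of a * s v → (P v ↔ P (FreeGroup.of a • v))) →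
      ∀ v, P v) :
    ∃ b : FreeGroupBasis (SchreierIndex s) K,
      ∀ i, (b i : FreeGroup A) = schreierGen s i.1.1 i.1.2 := by
  -- Tree edges carry the trivial label, so moving along the tree changes only the coset.
  have tree (v) : schreierPerm s (s v) ((1 : FreeGroup A), 1) = (v, 1) := by
    revert v
    refine ind _ (by simp [h1]) fun v a hva => ?_
    have : schreierPerm s (FreeGroup.of a) (v, 1) = (FreeGroup.of a • v, 1) := by
      simp [schreierPerm_of, schreierLabel, hva]
    rw [hva, map_mul, Equiv.Perm.mul_apply, ← this, Equiv.apply_eq_iff_eq]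
  have smul_one (k : K) : (k : FreeGroup A) • ((1 : FreeGroup A) : FreeGroup A ⧸ K) =
      (1 : FreeGroup A) := by
    rw [smul_one_coset, QuotientGroup.eq, mul_one]
    exact K.inv_mem k.2
  let ρ : K →* FreeGroup (SchreierIndex s) :=
    { toFun := fun k => (schreierPerm s (k : FreeGroup A) ((1 : FreeGroup A), 1)).2
      map_one' := by simp
      map_mul' := fun k l => by
        rw [Subgroup.coe_mul, map_mul, Equiv.Perm.mul_apply, schreierPerm_apply s l, smul_one,
          schreierPerm_apply s k] }
  let σ : FreeGroup (SchreierIndex s) →* K :=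
    FreeGroup.lift fun i => ⟨schreierGen s i.1.1 i.1.2, schreierGen_mem hs _ _⟩
  have hρσ : ρ.comp σ = MonoidHom.id _ := by
    ext i
    have : schreierPerm s (schreierGen s i.1.1 i.1.2) ((1 : FreeGroup A), 1) =
        (((1 : FreeGroup A) : FreeGroup A ⧸ K), FreeGroup.of i) := by
      rw [schreierGen, mul_assoc, map_mul, Equiv.Perm.mul_apply, map_inv,
        Equiv.Perm.inv_eq_iff_eq, map_mul, Equiv.Perm.mul_apply, tree, schreierPerm_of,
        schreierPerm_apply s (s _), tree, smul_one_coset, hs, schreierLabel, dif_pos i.2]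
      simp
    simp [ρ, σ, this]
  -- The Schreier generators met along `w` telescope. At the base coset, for `w` in `K`, both
  -- representatives are `1`, so `σ` inverts `ρ`.
  have key (w : FreeGroup A) (v : FreeGroup A ⧸ K) :
      (σ (schreierPerm s w (v, 1)).2 : FreeGroup A) = (s (w • v))⁻¹ * w * s v := by
    induction w using FreeGroup.induction_on generalizing v with
    | C1 => simp
    | of a =>
      rw [schreierPerm_of, mul_one]
      by_cases h : s (FreeGroup.of a • v) = FreeGroup.of a * s v
      · simp [schreierLabel, h]
      · simp [schreierLabel, h, σ, schreierGen]
    | inv_of a ih =>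
      have h2 := ih ((FreeGroup.of a)⁻¹ • v)
      have h3 : (schreierPerm s (FreeGroup.of a)⁻¹ (v, 1)).2 =
          (schreierPerm s (FreeGroup.of a) ((FreeGroup.of a)⁻¹ • v, 1)).2⁻¹ := by
        have : schreierPerm s ((FreeGroup.of a) * (FreeGroup.of a)⁻¹) (v, 1) = (v, 1) := by simp
        rw [map_mul, Equiv.Perm.mul_apply, schreierPerm_apply s (FreeGroup.of a)⁻¹,
          schreierPerm_apply s (FreeGroup.of a)] at this
        have := congrArg Prod.snd this
        simp only [mul_one] at this
        exact eq_inv_of_mul_eq_one_right this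
      rw [h3, map_inv, Subgroup.coe_inv, h2]
      simp [mul_assoc]
    | mul x y hx hy =>
      rw [map_mul, Equiv.Perm.mul_apply, schreierPerm_apply s y, schreierPerm_apply s x, mul_one, map_mul,
        Subgroup.coe_mul, hx, hy, mul_smul]
      group
  have hσρ : σ.comp ρ = MonoidHom.id _ := by
    refine MonoidHom.ext fun k => Subtype.ext ?_
    have := key k (1 : FreeGroup A)
    rw [smul_one, h1] at this
    simpa [ρ] using this
  refine ⟨.ofRepr (MonoidHom.toMulEquiv ρ σ hσρ hρσ), fun i => ?_⟩
  change (σ (FreeGroup.of i) : FreeGroup A) = _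
  simp [σ]

end Basis

/-! ### Primitive recursiveness of the enumeration -/

section Computability

/-- The list of all sublists. -/
def subLists {α : Type u} (l : List α) : List (List α) :=
  l.foldr (fun a L => L ++ L.map (a :: ·)) [[]]

theorem filter_mem_subLists {α : Type u} (p : α → Bool) (l : List α) :
    l.filter p ∈ subLists l := by
  induction l with
  | nil => simp [subLists]
  | cons a l ih =>
    by_cases h : p a
    · rw [List.filter_cons_of_pos h]
      exact List.mem_append_right _ (List.mem_map_of_mem ih)
    · rw [List.filter_cons_of_neg h]
      exact List.mem_append_left _ ih

theorem subset_of_mem_subLists {α : Type u} {l l' : List α} (h : l' ∈ subLists l) : l' ⊆ l := by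
  induction l generalizing l' with
  | nil => simp_all [subLists]
  | cons a l ih =>
    obtain h | h := List.mem_append.1 h
    · exact fun x hx => List.mem_cons_of_mem _ (ih h hx)
    · obtain ⟨m, hm, rfl⟩ := List.mem_map.1 h
      exact List.cons_subset_cons a (ih hm)

theorem primrec_subLists {α : Type u} [Primcodable α] : Primrec (subLists (α := α)) := by
  refine Primrec.list_foldr (α := List α) (β := α) Primrec.id (Primrec.const [[]]) (h := fun _ z => z.2 ++ z.2.map (z.1 :: ·)) ?_
  have h2 : Primrec fun y : List α × α × List (List α) => y.2.2 := Primrec.snd.comp Primrec.snd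
  refine Primrec.list_append.comp h2 (Primrec.list_map h2 (Primrec.list_cons.comp ?_ Primrec.snd))
  exact Primrec.fst.comp (Primrec.snd.comp Primrec.fst)

/-- The list of all prefixes. -/
def prefixList {α : Type u} (l : List α) : List (List α) :=
  l.foldr (fun a L => [] :: L.map (a :: ·)) [[]]

theorem mem_prefixList {α : Type u} {l u : List α} : u ∈ prefixList l ↔ u <+: l := by
  induction l generalizing u with
  | nil => simp [prefixList]
  | cons a l ih =>
    change u ∈ [] :: (prefixList l).map (a :: ·) ↔ _
    rw [List.prefix_cons_iff]
    simp [ih, and_comm, eq_comm]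

theorem primrec_prefixList {α : Type u} [Primcodable α] : Primrec (prefixList (α := α)) := by
  refine Primrec.list_foldr (α := List α) (β := α) Primrec.id (Primrec.const [[]]) (h := fun _ z => [] :: z.2.map (z.1 :: ·)) ?_
  have h2 : Primrec fun y : List α × α × List (List α) => y.2.2 := Primrec.snd.comp Primrec.snd
  refine Primrec.list_cons.comp (Primrec.const [])
    (Primrec.list_map h2 (Primrec.list_cons.comp ?_ Primrec.snd))
  exact Primrec.fst.comp (Primrec.snd.comp Primrec.fst)

theorem primrec_letterInv {A : Type u} [Primcodable A] : Primrec (letterInv (A := A)) :=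
  Primrec.fst.pair (Primrec.not.comp Primrec.snd)

theorem primrec_invRev {A : Type u} [Primcodable A] : Primrec (FreeGroup.invRev (α := A)) :=
  Primrec.list_reverse.comp
    (Primrec.list_map (α := FWord A) (β := A × Bool) Primrec.id (primrec_letterInv.comp Primrec.snd))

/-- The words of `X`, and the words `u v⁻¹` for the pairs `(u, v)` in `S`. -/
def enlarge {A : Type u} (X : List (FWord A)) (S : List (FWord A × FWord A)) : List (FWord A) :=
  X ++ S.map fun z => z.1 ++ FreeGroup.invRev z.2

theorem primrec_enlarge {A : Type u} [Primcodable A] : Primrec₂ (enlarge (A := A)) := by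
  refine Primrec.list_append.comp Primrec.fst (Primrec.list_map Primrec.snd (Primrec.list_append.comp
    (Primrec.fst.comp Primrec.snd) (primrec_invRev.comp (Primrec.snd.comp Primrec.snd))))

variable {A : Type u} [DecidableEq A]

/-- A right fold with a case distinction is a form in which primitive recursiveness can be read off.
-/
theorem reduce_eq_foldr (w : FWord A) :
    FreeGroup.reduce w = w.foldr (fun x v => List.casesOn v [x] fun y v' =>
      if x = (y.1, !y.2) then v' else x :: y :: v') [] := by
  induction w with
  | nil => rfl
  | cons x w ih =>
    rw [FreeGroup.reduce.cons, List.foldr_cons, ← ih]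
    cases FreeGroup.reduce w <;> simp [Prod.ext_iff]

theorem primrec_reduce [Primcodable A] : Primrec (FreeGroup.reduce (α := A)) := by
  refine Primrec.of_eq ?_ fun w => (reduce_eq_foldr w).symm
  refine Primrec.list_foldr (α := FWord A) (β := A × Bool) Primrec.id (Primrec.const [])
    (h := fun _ z => List.casesOn z.2 [z.1] fun y v' =>
      if z.1 = (y.1, !y.2) then v' else z.1 :: y :: v') ?_
  refine Primrec.list_casesOn (f := fun y : FWord A × (A × Bool) × FWord A => y.2.2)
    (g := fun y => [y.2.1]) (h := fun y t =>
      if y.2.1 = letterInv t.1 then t.2 else y.2.1 :: t.1 :: t.2)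
    (Primrec.snd.comp Primrec.snd)
    (Primrec.list_cons.comp (Primrec.fst.comp Primrec.snd) (Primrec.const [])) ?_
  have hx : Primrec fun y : (FWord A × (A × Bool) × FWord A) × (A × Bool) × FWord A => y.1.2.1 :=
    Primrec.fst.comp (Primrec.snd.comp Primrec.fst)
  refine Primrec.ite (Primrec.eq.comp hx (primrec_letterInv.comp (Primrec.fst.comp Primrec.snd)))
    (Primrec.snd.comp Primrec.snd)
    (Primrec.list_cons.comp hx (Primrec.list_cons.comp (Primrec.fst.comp Primrec.snd)
      (Primrec.snd.comp Primrec.snd)))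

/-- The list of the prefixes of the reduced forms of the words of a list. -/
def wordPrefixes (X : List (FWord A)) : List (FWord A) :=
  [] :: X.flatMap fun w => prefixList (FreeGroup.reduce w)

/-- The list of all pairs of prefixes of the reduced forms of the words of a list. -/
def prefixPairs (X : List (FWord A)) : List (FWord A × FWord A) :=
  (wordPrefixes X).flatMap fun u => (wordPrefixes X).map fun v => (u, v)

/-- Generating lists of the algebraic extension candidates of the subgroup generated by `X`. -/
def takahasiList (X : List (FWord A)) : List (List (FWord A)) :=
  (subLists (prefixPairs X)).map (enlarge X)

theorem primrec_wordPrefixes [Primcodable A] : Primrec (wordPrefixes (A := A)) :=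
  Primrec.list_cons.comp (Primrec.const []) (Primrec.list_flatMap Primrec.id
    (primrec_prefixList.comp (primrec_reduce.comp Primrec.snd)))

theorem primrec_prefixPairs [Primcodable A] : Primrec (prefixPairs (A := A)) := by
  refine Primrec.list_flatMap primrec_wordPrefixes (Primrec.list_map
    (primrec_wordPrefixes.comp Primrec.fst) (Primrec.pair ?_ Primrec.snd))
  exact Primrec.snd.comp Primrec.fst

theorem primrec_takahasiList [Primcodable A] : Primrec (takahasiList (A := A)) :=
  Primrec.list_map (primrec_subLists.comp primrec_prefixPairs) primrec_enlarge

end Computability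

open BasedAutomaton

/-! ### Connected subgraphs of Schreier graphs and free factors -/

section FreeFactor

variable {A : Type u}

/-- Every vertex other than the basepoint has a neighbour closer to the basepoint. -/
theorem BasedAutomaton.IsInverse.exists_rank {𝒜 : BasedAutomaton A} (h𝒜 : 𝒜.IsInverse) :
    ∃ r : 𝒜.V → ℕ, ∀ q, q ≠ 𝒜.base → ∃ p x, 𝒜.Edge p x q ∧ r p < r q := by
  classical
  have H (q : 𝒜.V) : ∃ n, ∃ u, 𝒜.Path 𝒜.base u q ∧ u.length = n :=
    let ⟨u, hu⟩ := h𝒜.exists_path q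
    ⟨_, u, hu, rfl⟩
  -- The rank is the length of a shortest path from the basepoint; the neighbour is the last vertex
  -- but one of such a path.
  refine ⟨fun q => Nat.find (H q), fun q hq => ?_⟩
  obtain ⟨u, hu, hlen⟩ := Nat.find_spec (H q)
  rcases u.eq_nil_or_concat' with rfl | ⟨u, x, rfl⟩
  · exact absurd (path_nil.1 hu).symm hq
  · obtain ⟨p, hp, hpq⟩ := path_append.1 hu
    obtain ⟨r, hr, hr'⟩ := path_cons.1 hpq
    obtain rfl := path_nil.1 hr'
    refine ⟨p, x, hr, ?_⟩
    change Nat.find (H p) < Nat.find (H r)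
    rw [← hlen]
    exact (Nat.find_min' (H p) ⟨u, hp, rfl⟩).trans_lt (by simp)

/-- A well-founded spanning tree extending a spanning tree of the image of a morphism. -/
theorem exists_wellFounded_parent {𝒜 ℬ : BasedAutomaton A} (h𝒜 : 𝒜.IsInverse) (hℬ : ℬ.IsInverse)
    (φ : Hom 𝒜 ℬ) :
    ∃ R : ℬ.V → ℬ.V → Prop, WellFounded R ∧ ∀ q, q ≠ ℬ.base → ∃ p x, R p q ∧ ℬ.Edge p x q ∧
      ∀ b : φ.image.V, b.1 = q → ∃ a : φ.image.V, a.1 = p ∧ φ.image.Edge a x b := by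
  classical
  obtain ⟨r, hr⟩ := hℬ.exists_rank
  obtain ⟨t, ht⟩ := (φ.image_isInverse h𝒜 hℬ).exists_rank
  -- Vertices of the image precede all others and are ranked by distance inside the image, so their
  -- parents stay in the image.
  let m : ℬ.V → ℕ ×ₗ ℕ := fun q =>
    if h : ∃ p, φ.toFun p = q then toLex (0, t ⟨q, h⟩) else toLex (1, r q)
  refine ⟨InvImage (· < ·) m, InvImage.wf m wellFounded_lt, fun q hq => ?_⟩
  by_cases h : ∃ p, φ.toFun p = q
  · obtain ⟨a, x, hax, hlt⟩ := ht ⟨q, h⟩ fun h' => hq (congrArg Subtype.val h')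
    refine ⟨a.1, x, ?_, φ.ofImage.map_edge _ _ _ hax, ?_⟩
    · simp only [InvImage, m, dif_pos h, dif_pos a.2]
      exact Prod.Lex.toLex_lt_toLex.2 (.inr ⟨rfl, hlt⟩)
    · rintro b rfl
      exact ⟨a, rfl, hax⟩
  · obtain ⟨p, x, hpx, hlt⟩ := hr q hq
    refine ⟨p, x, ?_, hpx, ?_⟩
    · simp only [InvImage, m, dif_neg h]
      by_cases hp : ∃ p', φ.toFun p' = p
      · rw [dif_pos hp]
        exact Prod.Lex.toLex_lt_toLex.2 (.inl Nat.zero_lt_one)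
      · rw [dif_neg hp]
        exact Prod.Lex.toLex_lt_toLex.2 (.inr ⟨rfl, hlt⟩)
    · rintro b rfl
      exact absurd b.2 h

/-- The loops of a connected subgraph of the Schreier graph of `K` form a free factor of `K`. -/
theorem image_loops_isFreeFactor [DecidableEq A] {𝒜 : BasedAutomaton A} (h𝒜 : 𝒜.IsInverse)
    (K : Subgroup (FreeGroup A)) (φ : Hom 𝒜 (schreierAutomaton K)) :
    IsFreeFactor (φ.image_isInverse h𝒜 (schreier_isInverse K)).loops K := by
  classical
  have hI := φ.image_isInverse h𝒜 (schreier_isInverse K)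
  obtain ⟨R, hR, hpar⟩ := exists_wellFounded_parent h𝒜 (schreier_isInverse K) φ
  change FreeGroup A ⧸ K → FreeGroup A ⧸ K → Prop at R
  replace hR : WellFounded (α := FreeGroup A ⧸ K) R := hR
  change ∀ q : FreeGroup A ⧸ K, q ≠ (1 : FreeGroup A) → ∃ (p : FreeGroup A ⧸ K) (x : A × Bool),
    R p q ∧ p = FreeGroup.mk [x] • q ∧ _ at hpar
  choose par lab hRpar hedge himg using hpar
  -- `s q` is the inverse of the label of the tree path from the basepoint to `q`; the inverse
  -- appears because cosets are left cosets.
  obtain ⟨s, h1, hs'⟩ : ∃ s : FreeGroup A ⧸ K → FreeGroup A, s (1 : FreeGroup A) = 1 ∧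
      ∀ q hq, s q = (FreeGroup.mk [lab q hq])⁻¹ * s (par q hq) := by
    refine ⟨hR.fix fun q ih => if h : q = (1 : FreeGroup A) then 1 else
      (FreeGroup.mk [lab q h])⁻¹ * ih (par q h) (hRpar q h), ?_, fun q hq => ?_⟩
    · rw [hR.fix_eq, dif_pos rfl]
    · rw [hR.fix_eq, dif_neg hq]
  have hs (v) : (s v : FreeGroup A ⧸ K) = v := by
    induction v using hR.induction with
    | h q ih =>
      by_cases hq : q = (1 : FreeGroup A)
      · rw [hq, h1]
      · have h2 := ih _ (hRpar q hq)
        rw [hs' q hq]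
        change (FreeGroup.mk [lab q hq])⁻¹ • (s (par q hq) : FreeGroup A ⧸ K) = q
        rw [h2, inv_smul_eq_iff]
        exact hedge q hq
  obtain ⟨b, hb⟩ := exists_schreierBasis hs h1 fun P hP hstep v => by
    induction v using hR.induction with
    | h q ih =>
      by_cases hq : q = (1 : FreeGroup A)
      · rwa [hq]
      · have h2 := ih _ (hRpar q hq)
        have h3 := hs' q hq
        have h4 := hedge q hq
        -- According to the sign of its letter, the tree edge is indexed by the parent or by `q`.
        rcases hl : lab q hq with ⟨a, _ | _⟩
        · rw [hl] at h3 h4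
          change s q = ((FreeGroup.of a)⁻¹)⁻¹ * _ at h3
          change _ = (FreeGroup.of a)⁻¹ • q at h4
          rw [inv_inv] at h3
          rw [eq_inv_smul_iff] at h4
          have := hstep (par q hq) a (by rw [h4, h3])
          rw [h4] at this
          exact this.1 h2
        · rw [hl] at h3 h4
          change s q = (FreeGroup.of a)⁻¹ * _ at h3
          change _ = FreeGroup.of a • q at h4
          have := hstep q a (by rw [← h4, h3, mul_inv_cancel_left])
          rw [← h4] at this
          exact this.2 h2
  -- The tree path to a vertex of the image runs inside the image.
  have hsI (v : FreeGroup A ⧸ K) : ∀ c : φ.image.V, c.1 = v →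
      ∃ u, φ.image.Path φ.image.base u c ∧ s v = (FreeGroup.mk u)⁻¹ := by
    induction v using hR.induction with
    | h q ih =>
      intro c hc
      by_cases hq : q = (1 : FreeGroup A)
      · refine ⟨[], path_nil.2 (Subtype.ext (hc.trans hq).symm), ?_⟩
        rw [hq, h1, ← FreeGroup.one_eq_mk, inv_one]
      · obtain ⟨a, ha, hac⟩ := himg q hq c hc
        obtain ⟨u, hu, hsu⟩ := ih _ (hRpar q hq) a ha
        refine ⟨u ++ [lab q hq], hu.append (.single hac), ?_⟩
        rw [hs' q hq, hsu, ← FreeGroup.mul_mk, mul_inv_rev]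
  -- The chosen part of the basis belongs to positive edges of the image. The generator of `(w, a)`
  -- belongs to the edge from `a • w` to `w`, hence is indexed by the end of that edge.
  refine ⟨SchreierIndex s, b,
    {i | ∃ p q : φ.image.V, φ.image.Edge p (i.1.2, true) q ∧ q.1 = i.1.1}, ?_⟩
  set M : Subgroup (FreeGroup A) := Subgroup.closure _ with hM
  have hsmul (p q : φ.image.V) (v w : FreeGroup A ⧸ K) (hv : p.1 = v) (hw : q.1 = w) (a : A)
      (h : φ.image.Edge p (a, true) q) : v = FreeGroup.of a • w := by
    rw [← hv, ← hw]
    exact φ.ofImage.map_edge _ _ _ h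
  have hgen (p q : φ.image.V) (a : A) (h : φ.image.Edge p (a, true) q) :
      (s p.1)⁻¹ * FreeGroup.of a * s q.1 ∈ M := by
    obtain ⟨v, hv⟩ : ∃ v : FreeGroup A ⧸ K, p.1 = v := ⟨_, rfl⟩
    obtain ⟨w, hw⟩ : ∃ w : FreeGroup A ⧸ K, q.1 = w := ⟨_, rfl⟩
    rw [hv, hw, hsmul p q v w hv hw a h]
    by_cases hi : s (FreeGroup.of a • w) = FreeGroup.of a * s w
    · rw [hi, mul_assoc, inv_mul_cancel]
      exact one_mem _
    · exact Subgroup.subset_closure ⟨⟨(w, a), hi⟩, ⟨p, q, h, hw⟩, hb _⟩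
  apply le_antisymm
  · have key : ∀ (p : φ.image.V) w q, φ.image.Path p w q →
        (s p.1)⁻¹ * FreeGroup.mk w * s q.1 ∈ M := by
      intro p w q h
      induction h with
      | nil p =>
        rw [← FreeGroup.one_eq_mk, mul_one, inv_mul_cancel]
        exact one_mem _
      | @cons p r q x w hpr _ ih =>
        have h3 : (s p.1)⁻¹ * FreeGroup.mk [x] * s r.1 ∈ M := by
          rcases x with ⟨a, _ | _⟩
          · have := inv_mem (hgen _ _ _ (hI.involutive _ _ _ hpr))
            rw [mul_inv_rev, mul_inv_rev, inv_inv, ← mul_assoc] at this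
            exact this
          · exact hgen _ _ _ hpr
        have := mul_mem h3 ih
        rw [mk_cons]
        convert this using 1
        group
    rintro _ ⟨w, hw, rfl⟩
    have := key _ w _ hw
    have hbase : s (φ.image.base).1 = 1 := h1
    rwa [hbase, inv_one, one_mul, mul_one] at this
  · rw [hM, Subgroup.closure_le]
    rintro _ ⟨i, ⟨p, q, hpq, hq⟩, rfl⟩
    obtain ⟨u, hu, hsu⟩ := hsI _ p rfl
    obtain ⟨v, hv, hsv⟩ := hsI _ q hq
    have := hI.mul_inv_mem_loops (hu.append (.single hpq)) hv
    simp only [hb]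
    rw [schreierGen, ← hsmul p q _ _ rfl hq _ hpq, hsu, hsv, inv_inv]
    exact this

theorem IsFreeFactor.le {G : Type u} [Group G] {L K : Subgroup G} (h : IsFreeFactor L K) :
    L ≤ K := by
  obtain ⟨ι, b, S, rfl⟩ := h
  rw [Subgroup.closure_le]
  rintro _ ⟨i, -, rfl⟩
  exact (b i).2

end FreeFactor

/-! ### The listed subgroups and the morphic images -/

section Takahasi

variable {A : Type u} [DecidableEq A]

theorem mem_wordPrefixes {X : List (FWord A)} {u : FWord A} :
    u ∈ wordPrefixes X ↔ u ∈ petalPrefixes (listElems X) := by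
  simp [wordPrefixes, petalPrefixes, listElems, mem_prefixList, ← FreeGroup.toWord_mk]

theorem mem_prefixPairs {X : List (FWord A)} {u v : FWord A} :
    (u, v) ∈ prefixPairs X ↔
      u ∈ petalPrefixes (listElems X) ∧ v ∈ petalPrefixes (listElems X) := by
  simp [prefixPairs, mem_wordPrefixes]

omit [DecidableEq A] in
theorem listElems_enlarge (X : List (FWord A)) (S : List (FWord A × FWord A)) :
    listElems (enlarge X S) =
      listElems X ∪ {g | ∃ u v, (u, v) ∈ S ∧ FreeGroup.mk u * (FreeGroup.mk v)⁻¹ = g} := by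
  ext g
  simp only [listElems, enlarge, List.mem_append, List.mem_map, Prod.exists, Set.mem_ofPred_eq,
    Set.mem_union, FreeGroup.inv_mk, FreeGroup.mul_mk]
  constructor
  · rintro ⟨w, hw | ⟨u, v, h, rfl⟩, rfl⟩
    · exact .inl ⟨w, hw, rfl⟩
    · exact .inr ⟨u, v, h, rfl⟩
  · rintro (⟨w, hw, rfl⟩ | ⟨u, v, h, rfl⟩)
    · exact ⟨w, .inl hw, rfl⟩
    · exact ⟨_, .inr ⟨u, v, h, rfl⟩, rfl⟩

theorem listElems_subset_of_mem_takahasiList {X Y : List (FWord A)} (h : Y ∈ takahasiList X) :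
    listElems X ⊆ listElems Y := by
  obtain ⟨S, -, rfl⟩ := List.mem_map.1 h
  rw [listElems_enlarge]
  exact Set.subset_union_left

/-- The loops of every morphic image are generated by one of the lists. -/
theorem exists_mem_takahasiList {X : List (FWord A)} {ℬ : BasedAutomaton A} (hℬ : ℬ.IsInverse)
    (φ : Hom (stallingsAutomaton (listElems X)) ℬ) :
    ∃ Y ∈ takahasiList X,
      (φ.image_isInverse (stallings_isInverse _) hℬ).loops = listSubgroup Y := by
  classical
  -- The pairs chosen are those whose paths in `ℬ` share an end vertex. This choice need not be
  -- decidable, since all sublists are enumerated.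
  refine ⟨_, List.mem_map_of_mem (filter_mem_subLists
    (fun z => decide (∃ p, ℬ.Path ℬ.base z.1 p ∧ ℬ.Path ℬ.base z.2 p)) _), ?_⟩
  rw [image_loops_eq_closure hℬ φ, listSubgroup, listElems_enlarge]
  congr 2
  ext g
  simp only [Set.mem_ofPred_eq, List.mem_filter, mem_prefixPairs, decide_eq_true_eq]
  constructor
  · rintro ⟨u, hu, v, hv, h, rfl⟩
    exact ⟨u, v, ⟨⟨hu, hv⟩, h⟩, rfl⟩
  · rintro ⟨u, v, ⟨⟨hu, hv⟩, h⟩, rfl⟩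
    exact ⟨u, hu, v, hv, h, rfl⟩

/-- Each adjoined `u * v⁻¹` is a loop in the Stallings automaton of `Y`, so `u` and `v` end at the
same vertex there. The image thus already has all generators of `Y` among its loops. -/
theorem loops_image_of_mem_takahasiList {X Y : List (FWord A)} (hY : Y ∈ takahasiList X)
    (φ : Hom (stallingsAutomaton (listElems X)) (stallingsAutomaton (listElems Y))) :
    (φ.image_isInverse (stallings_isInverse _) (stallings_isInverse _)).loops =
      listSubgroup Y := by
  have hsY := stallings_isInverse (listElems Y)
  apply le_antisymm
  · exact (IsInverse.loops_mono _ hsY φ.ofImage).trans_eq (stallings_loops _)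
  · obtain ⟨S, hS, rfl⟩ := List.mem_map.1 hY
    rw [image_loops_eq_closure hsY φ]
    refine Subgroup.closure_mono ((listElems_enlarge X S).trans_subset ?_)
    refine Set.union_subset_union_right _ ?_
    rintro _ ⟨u, v, huv, rfl⟩
    obtain ⟨hu, hv⟩ := mem_prefixPairs.1 (subset_of_mem_subLists hS huv)
    refine ⟨u, hu, v, hv, ?_, rfl⟩
    obtain ⟨p, hp⟩ := stallings_exists_path_prefix hu
    obtain ⟨q, hq⟩ := stallings_exists_path_prefix hv
    have hpq := hsY.eq_of_mul_inv_mem_loops (hp.map_base φ) (hq.map_base φ) (by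
      rw [stallings_loops, listElems_enlarge]
      exact Subgroup.subset_closure (.inr ⟨u, v, huv, rfl⟩))
    exact ⟨_, hp.map_base φ, hpq ▸ hq.map_base φ⟩

end Takahasi

theorem mainTheorem11 {A : Type u} [Finite A] [DecidableEq A] [Primcodable A] :
    ∃ f : List (FWord A) → List (List (FWord A)),
      Computable f ∧
      ∀ X : List (FWord A),
        (∀ Y ∈ f X, listSubgroup X ≤ listSubgroup Y) ∧
        (∀ K : Subgroup (FreeGroup A), K.FG →
          (listSubgroup X ≤ K ↔ ∃ Y ∈ f X, IsFreeFactor (listSubgroup Y) K)) ∧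
        (∀ Y ∈ f X, ∃ (ℬ : BasedAutomaton A)
          (φ : (stallingsAutomaton (listElems X)).Hom ℬ), ℬ.IsInverse ∧
            Nonempty ((stallingsAutomaton (listElems Y)).Iso φ.image)) ∧
        (∀ (ℬ : BasedAutomaton A) (φ : (stallingsAutomaton (listElems X)).Hom ℬ), ℬ.IsInverse →
          ∃ Y ∈ f X, Nonempty ((stallingsAutomaton (listElems Y)).Iso φ.image)) := by
  have hle (X Y : List (FWord A)) (h : Y ∈ takahasiList X) : listSubgroup X ≤ listSubgroup Y :=
    Subgroup.closure_mono (listElems_subset_of_mem_takahasiList h)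
  refine ⟨takahasiList, primrec_takahasiList.to_comp, fun X => ⟨hle X, fun K _ => ⟨fun hK => ?_,
    fun ⟨Y, hY, h⟩ => (hle X Y hY).trans h.le⟩, fun Y hY => ?_, fun ℬ φ hℬ => ?_⟩⟩
  · obtain ⟨φ⟩ := exists_stallingsHom (X := listElems X) (schreier_isInverse K) fun g hg => by
      rw [schreier_loops]; exact hK (Subgroup.subset_closure hg)
    obtain ⟨Y, hY, h⟩ := exists_mem_takahasiList (schreier_isInverse K) φ
    exact ⟨Y, hY, h ▸ image_loops_isFreeFactor (stallings_isInverse _) K φ⟩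
  · have hXY : listElems X ⊆ Subgroup.closure (listElems Y) :=
      (listElems_subset_of_mem_takahasiList hY).trans Subgroup.subset_closure
    have hsY := stallings_isInverse (listElems Y)
    obtain ⟨φ⟩ := exists_stallingsHom (X := listElems X) hsY fun g hg => by
      rw [stallings_loops]; exact hXY hg
    exact ⟨_, φ, hsY, stallings_iso_image hsY φ hXY (loops_image_of_mem_takahasiList hY φ)⟩
  · obtain ⟨Y, hY, h⟩ := exists_mem_takahasiList hℬ φ
    exact ⟨Y, hY, stallings_iso_image hℬ φ
      ((listElems_subset_of_mem_takahasiList hY).trans Subgroup.subset_closure) h⟩
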